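/- Let $n\ge 0$, let $\mathbf S^n$ be the space of real symmetric $n\times n$ matrices with the inner product $\langle A,B\rangle=\operatorname{tr}(AB)$, and for a real symmetric matrix $A$ let $\lambda(A)$ be the vector of its eigenvalues (with multiplicity) in nonincreasing order and $\Lambda(A)=\operatorname{Diag}(\lambda(A))$. For $A\in\mathbf S^n$ let $\mathbf O^n(A)$ be the set of orthogonal $U$ with $A=U\Lambda(A)U^\top$. Two symmetric matrices $A,B$ of the same size have a *simultaneous ordered spectral decomposition* if there is an orthogonal $Q$ with $Q^\top AQ=\Lambda(A)$ and $Q^\top BQ=\Lambda(B)$. For an extended-real-valued function $f$ on a finite-dimensional Euclidean space and a point $x$ with $f(x)$ finite, put $\partial f(x)=\{v : f(z)\ge f(x)+\langle v,z-x\rangle\ \text{for all } z\}$, $$\mathrm df(x)(w)=\liminf_{t\downarrow0,\ w'\to w}\frac{f(x+tw')-f(x)}{t},\qquad K_f(x,v)=\{w : \mathrm df(x)(w)=\langle v,w\rangle\}\quad\text{for } v\in\partial f(x).$$ Let $\theta:\mathbf R^n\to[-\infty,\infty]$ be symmetric (invariant under all permutations of the coordinates), assume that $g=\theta\circ\lambda:\mathbf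 S^n\to[-\infty,\infty]$ is lower semicontinuous and convex, and let $X,Y\in\mathbf S^n$ with $g(X)$ finite and $Y\in\partial g(X)$. Let $\mu_1>\dots>\mu_r$ be the distinct eigenvalues of $X$ and $\alpha_m=\{i : \lambda_i(X)=\mu_m\}$ for $m=1,\dots,r$. Then $\mathbf O^n(X)\cap\mathbf O^n(Y)\neq\emptyset$, $\lambda(Y)\in\partial\theta(\lambda(X))$, and the directional derivative $\lambda'(X;H)=\lim_{t\downarrow0}\frac{\lambda(X+tH)-\lambda(X)}{t}$ exists for every $H\in\mathbf S^n$. Moreover, for every $U\in\mathbf O^n(X)\cap\mathbf O^n(Y)$ and every $H\in\mathbf S^n$, one has $H\in K_g(X,Y)$ if and only if $\lambda'(X;H)\in K_\theta(\lambda(X),\lambda(Y))$ and, for each $m=1,\dots,r$, the matrices $\Lambda(Y)_{\alpha_m\alpha_m}$ (the block of $\Lambda(Y)$ with rows and columns in $\alpha_m$) and $U_{\alpha_m}^\top HU_{\alpha_m}$ (where $U_{\alpha_m}$ consists of the columns of $U$ with index in $\alpha_m$) have a simultaneous ordered spectral decomposition. -/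

import Mathlib

open Filter Topology
open scoped Matrix Matrix.Norms.Frobenius

namespace SpectralCone

noncomputable section

/-! ### Extended-real-valued functions on a real inner product space -/

section General

variable {E F : Type*} [NormedAddCommGroup E] [InnerProductSpace ℝ E]
  [NormedAddCommGroup F] [NormedSpace ℝ F]

/-- An extended-real-valued function is convex if its epigraph is a convex set. -/
def IsConvexFun (f : E → EReal) : Prop :=
  Convex ℝ {p : E × ℝ | f p.1 ≤ (p.2 : EReal)}

/-- The subdifferential of convex analysis at a point where `f` is finite
(it is empty at all other points). -/
def subdifferential (f : E → EReal) (x : E) : Set E :=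
  {v | f x ≠ ⊥ ∧ f x ≠ ⊤ ∧ ∀ z : E, f x + ((inner ℝ v (z - x) : ℝ) : EReal) ≤ f z}

/-- The subderivative `df(x)(w)`, the lower limit of `(f (x + t w') - f x) / t`
as `t ↓ 0` and `w' → w`. -/
def subderivative (f : E → EReal) (x w : E) : EReal :=
  liminf (fun p : ℝ × E => (f (x + p.1 • p.2) - f x) / (p.1 : EReal)) (𝓝[>] (0 : ℝ) ×ˢ 𝓝 w)

/-- The critical cone `K_f(x, v)` of `f` at `x` for `v`. -/
def criticalCone (f : E → EReal) (x v : E) : Set E :=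
  {w | subderivative f x w = ((inner ℝ v w : ℝ) : EReal)}

/-- The (one-sided) directional derivative of `f` at `x` is `d` in the direction `w`. -/
def HasDirDeriv (f : E → F) (x w : E) (d : F) : Prop :=
  Tendsto (fun t : ℝ => t⁻¹ • (f (x + t • w) - f x)) (𝓝[>] 0) (𝓝 d)

/-- The (one-sided) directional derivative `f'(x; w)`. -/
def dirDeriv (f : E → F) (x w : E) : F :=
  limUnder (𝓝[>] (0 : ℝ)) (fun t : ℝ => t⁻¹ • (f (x + t • w) - f x))

end General

/-! ### Symmetric matrices and their ordered eigenvalues -/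

section Symm

variable {ι : Type*}

variable (ι) in
/-- The space of real symmetric matrices with rows and columns indexed by `ι`. It carries the
Frobenius norm inherited from the space of all matrices. -/
def symMat : Submodule ℝ (Matrix ι ι ℝ) where
  carrier := {A | A.IsSymm}
  add_mem' := fun ha hb => Matrix.IsSymm.add ha hb
  zero_mem' := Matrix.isSymm_zero
  smul_mem' := fun c _ ha => Matrix.IsSymm.smul ha c

theorem symMat_isSymm (A : symMat ι) : (A : Matrix ι ι ℝ).IsSymm := A.2

theorem symMat_isHermitian (A : symMat ι) : (A : Matrix ι ι ℝ).IsHermitian := by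
  rw [Matrix.IsHermitian, Matrix.conjTranspose_eq_transpose_of_trivial]
  exact A.2

variable [Fintype ι]

/-- The trace inner product `⟨A, B⟩ = tr (A B)`, whose norm is the Frobenius norm. -/
instance : InnerProductSpace ℝ (symMat ι) where
  inner A B := ((A : Matrix ι ι ℝ) * (B : Matrix ι ι ℝ)).trace
  norm_sq_eq_re_inner A := by
    have h : ‖A‖ = ‖(A : Matrix ι ι ℝ)‖ := rfl
    have hs : ∀ i j, (A : Matrix ι ι ℝ) j i = (A : Matrix ι ι ℝ) i j := (symMat_isSymm A).apply
    have hn : 0 ≤ ∑ i, ∑ j, ‖(A : Matrix ι ι ℝ) i j‖ ^ (2 : ℝ) := by positivity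
    rw [h, Matrix.frobenius_norm_def, ← Real.sqrt_eq_rpow, Real.sq_sqrt hn]
    simp [Matrix.trace, Matrix.mul_apply, hs, pow_two]
  conj_inner_symm A B := by
    simpa using Matrix.trace_mul_comm (B : Matrix ι ι ℝ) (A : Matrix ι ι ℝ)
  add_left A B C := by simp [Matrix.add_mul]
  smul_left A B r := by simp

variable [LinearOrder ι]

/-- The eigenvalue vector `λ(A)`: the eigenvalues of `A`, repeated with multiplicity and
arranged in nonincreasing order along the linear order of the index type. -/
def eig (A : symMat ι) : EuclideanSpace ℝ ι :=
  WithLp.toLp 2 fun i =>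
    (symMat_isHermitian A).eigenvalues₀ ((Fintype.orderIsoFinOfCardEq ι rfl).symm i)

/-- `Q ∈ 𝐎(A)`: `Q` is orthogonal and `A = Q Diag(λ(A)) Qᵀ`. -/
def orthDiag (A : symMat ι) : Set (Matrix ι ι ℝ) :=
  {Q | Q ∈ Matrix.orthogonalGroup ι ℝ ∧
    (A : Matrix ι ι ℝ) = Q * Matrix.diagonal (eig A) * Qᵀ}

/-- `A` and `B` have a simultaneous ordered spectral decomposition. -/
def HasSimOrdSpectralDecomp (A B : symMat ι) : Prop :=
  ∃ Q ∈ Matrix.orthogonalGroup ι ℝ,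
    Qᵀ * (A : Matrix ι ι ℝ) * Q = Matrix.diagonal (eig A) ∧
    Qᵀ * (B : Matrix ι ι ℝ) * Q = Matrix.diagonal (eig B)

/-- The index set `{i | λ_i(A) = c}`. -/
def eigIndex (A : symMat ι) (c : ℝ) : Finset ι :=
  Finset.univ.filter fun i => eig A i = c

/-- The block `Λ(A)_{ss}` of the diagonal matrix `Λ(A) = Diag(λ(A))`. -/
def eigDiagBlock (A : symMat ι) (s : Finset ι) : symMat s :=
  ⟨(Matrix.diagonal (eig A)).submatrix Subtype.val Subtype.val,
    (Matrix.isSymm_diagonal _).submatrix _⟩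

/-- The matrix `U_sᵀ H U_s`, where `U_s` consists of the columns of `U` with index in `s`. -/
def colCompression (U : Matrix ι ι ℝ) (s : Finset ι) (H : symMat ι) : symMat s :=
  ⟨(U.submatrix id (Subtype.val : s → ι))ᵀ * (H : Matrix ι ι ℝ) *
      U.submatrix id (Subtype.val : s → ι), by
    change Matrix.IsSymm _
    rw [Matrix.IsSymm, Matrix.transpose_mul, Matrix.transpose_mul, Matrix.transpose_transpose,
      (symMat_isSymm H).eq, Matrix.mul_assoc]⟩

end Symm

/-- A function on `ℝⁿ` is symmetric if it is invariant under permutations of coordinates. -/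
def IsSymmetricFun {n : ℕ} (θ : EuclideanSpace ℝ (Fin n) → EReal) : Prop :=
  ∀ (σ : Equiv.Perm (Fin n)) (x : EuclideanSpace ℝ (Fin n)),
    θ (WithLp.toLp 2 fun i => x (σ i)) = θ x

end

end SpectralCone

/-!
The proof rests on the trace inequality `tr (A B) ≤ ⟨eig A, eig B⟩` (`inner_le_sum_eig`), which follows
from Birkhoff's theorem and the rearrangement inequality, and on its equality case: equality holds
exactly if `A` and `B` have a common ordered diagonalization
(`hasSimOrdSpectralDecomp_iff_inner_eq`). The inequality also shows that `eig` is nonexpansive and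
that any ordered diagonalization of a matrix displays its ordered eigenvalues.

If `Y` is a subgradient of `g = θ ∘ eig` at `X`, testing the subgradient inequality at conjugates of
`X`, on which `g` is constant, forces equality in the trace inequality for `X` and `Y`. This gives
a common diagonalization, and restricting to matrices diagonalized by it shows that `eig Y` is a
subgradient of `θ`.

For antitone `y` the function `⟨y, eig ·⟩` is the support function of the orbit of `Diag(y)`. Its
directional derivative at `X` along `H` is the maximum of `⟨V Diag(y) Vᵀ, H⟩` over the
diagonalizations `V` of `X`, and the trace inequality within each eigenspace of `X` evaluates that
maximum as `blockPairing` (`tendsto_slope_inner_eig`). Differences of antitone vectors give the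
directional differentiability of each eigenvalue.

Finally, the chain rule `subderivative_spectral` identifies `dg(X)(H)` with
`dθ(eig X)(dirDeriv eig X H)`, and there is a chain
`⟨Y, H⟩ ≤ ⟨eig Y, dirDeriv eig X H⟩ ≤ dθ(eig X)(dirDeriv eig X H) = dg(X)(H)`.
So `H` is critical for `g` exactly if both inequalities are equalities. The second one being an
equality means that `dirDeriv eig X H` is critical for `θ`; the first one means that every block is
an equality case of the trace inequality (`inner_le_inner_dirDeriv_eig`).
-/

namespace SpectralCone

noncomputable section

/-! ### The trace inequality for orthogonal conjugates of diagonal matrices -/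

section Trace

variable {ι : Type*} [Fintype ι] [LinearOrder ι]

theorem transpose_mul_self {Q : Matrix ι ι ℝ} (hQ : Q ∈ Matrix.orthogonalGroup ι ℝ) :
    Qᵀ * Q = 1 :=
  (Matrix.mem_orthogonalGroup_iff' ι ℝ).1 hQ

theorem mul_transpose_self {Q : Matrix ι ι ℝ} (hQ : Q ∈ Matrix.orthogonalGroup ι ℝ) :
    Q * Qᵀ = 1 :=
  (Matrix.mem_orthogonalGroup_iff ι ℝ).1 hQ

theorem mem_orthogonalGroup_of_transpose_mul_self {Q : Matrix ι ι ℝ} (hQ : Qᵀ * Q = 1) :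
    Q ∈ Matrix.orthogonalGroup ι ℝ :=
  (Matrix.mem_orthogonalGroup_iff' ι ℝ).2 hQ

theorem transpose_mem_orthogonalGroup {Q : Matrix ι ι ℝ} (hQ : Q ∈ Matrix.orthogonalGroup ι ℝ) :
    Qᵀ ∈ Matrix.orthogonalGroup ι ℝ :=
  mem_orthogonalGroup_of_transpose_mul_self (by
    rw [Matrix.transpose_transpose, mul_transpose_self hQ])

theorem abs_entry_le_one {Q : Matrix ι ι ℝ} (hQ : Q ∈ Matrix.orthogonalGroup ι ℝ) (i j : ι) :
    |Q i j| ≤ 1 := by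
  have h := congrFun (congrFun (mul_transpose_self hQ) i) i
  simp only [Matrix.mul_apply, Matrix.transpose_apply, Matrix.one_apply_eq] at h
  rw [abs_le_one_iff_mul_self_le_one, ← h]
  exact Finset.single_le_sum (f := fun k => Q i k * Q i k) (fun k _ => mul_self_nonneg _)
    (Finset.mem_univ j)

/-- The squared entries of an orthogonal matrix form a doubly stochastic matrix, which by
Birkhoff's theorem is a convex combination of permutation matrices. The rearrangement inequality
bounds each of these. -/
theorem sum_mul_sq_le_of_antitone {a b : ι → ℝ} (ha : Antitone a) (hb : Antitone b)
    {W : Matrix ι ι ℝ} (hW : W ∈ Matrix.orthogonalGroup ι ℝ) :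
    ∑ i, ∑ j, a i * b j * W i j ^ 2 ≤ ∑ i, a i * b i := by
  have hS : (Matrix.of fun i j => W i j ^ 2) ∈ doublyStochastic ℝ ι := by
    rw [mem_doublyStochastic_iff_sum]
    refine ⟨fun i j => by simpa using sq_nonneg _, fun i => ?_, fun j => ?_⟩
    · simpa [Matrix.mul_apply, ← pow_two] using
        congrFun (congrFun (mul_transpose_self hW) i) i
    · simpa [Matrix.mul_apply, ← pow_two] using
        congrFun (congrFun (transpose_mul_self hW) j) j
  obtain ⟨w, hw0, hw1, hw⟩ := exists_eq_sum_perm_of_mem_doublyStochastic hS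
  have hent : ∀ i j, W i j ^ 2 = ∑ σ : Equiv.Perm ι, w σ * (if σ i = j then 1 else 0) := by
    intro i j
    have := congrFun (congrFun hw i) j
    simpa [Matrix.sum_apply, Equiv.toPEquiv_apply, PEquiv.toMatrix_apply, Equiv.Perm.permMatrix,
      eq_comm] using this.symm
  have hab : Monovary a b := fun i j hij => ha (le_of_not_ge fun h => (hb h).not_gt hij)
  calc ∑ i, ∑ j, a i * b j * W i j ^ 2
      = ∑ σ : Equiv.Perm ι, w σ * ∑ i, a i * b (σ i) := by
        simp_rw [hent, Finset.mul_sum]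
        rw [Finset.sum_congr rfl fun i _ => Finset.sum_comm, Finset.sum_comm]
        refine Finset.sum_congr rfl fun σ _ => Finset.sum_congr rfl fun i _ => ?_
        rw [Finset.sum_eq_single (σ i)]
        · simp; ring
        · intro j _ hj
          simp [hj.symm]
        · simp
    _ ≤ ∑ σ : Equiv.Perm ι, w σ * ∑ i, a i * b i :=
        Finset.sum_le_sum fun σ _ =>
          mul_le_mul_of_nonneg_left hab.sum_mul_comp_perm_le_sum_mul (hw0 σ)
    _ = ∑ i, a i * b i := by rw [← Finset.sum_mul, hw1, one_mul]

/-- The symmetric matrix `Q Diag(a) Qᵀ`. -/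
def conjDiag (Q : Matrix ι ι ℝ) (a : ι → ℝ) : symMat ι :=
  ⟨Q * Matrix.diagonal a * Qᵀ, by
    change Matrix.IsSymm _
    rw [Matrix.IsSymm, Matrix.transpose_mul, Matrix.transpose_mul, Matrix.transpose_transpose,
      Matrix.diagonal_transpose, Matrix.mul_assoc]⟩

theorem coe_conjDiag (Q : Matrix ι ι ℝ) (a : ι → ℝ) :
    (conjDiag Q a : Matrix ι ι ℝ) = Q * Matrix.diagonal a * Qᵀ := rfl

theorem conjDiag_add (Q : Matrix ι ι ℝ) (a b : ι → ℝ) :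
    conjDiag Q (a + b) = conjDiag Q a + conjDiag Q b := by
  apply Subtype.ext
  simp only [coe_conjDiag, Submodule.coe_add, ← Matrix.diagonal_add, Matrix.mul_add,
    Matrix.add_mul, Pi.add_def]

theorem conjDiag_sub (Q : Matrix ι ι ℝ) (a b : ι → ℝ) :
    conjDiag Q (a - b) = conjDiag Q a - conjDiag Q b := by
  rw [eq_sub_iff_add_eq, ← conjDiag_add, sub_add_cancel]

omit [LinearOrder ι] in
theorem inner_def (A B : symMat ι) :
    inner ℝ A B = ((A : Matrix ι ι ℝ) * (B : Matrix ι ι ℝ)).trace := rfl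

theorem inner_conjDiag_left (Q : Matrix ι ι ℝ) (a : ι → ℝ) (B : symMat ι) :
    inner ℝ (conjDiag Q a) B = ∑ i, a i * (Qᵀ * (B : Matrix ι ι ℝ) * Q) i i := by
  rw [inner_def, coe_conjDiag, Matrix.mul_assoc, Matrix.mul_assoc, Matrix.trace_mul_comm,
    Matrix.mul_assoc]
  simp [Matrix.trace, Matrix.diagonal_mul, Matrix.mul_assoc]

theorem inner_conjDiag (P Q : Matrix ι ι ℝ) (a b : ι → ℝ) :
    inner ℝ (conjDiag P a) (conjDiag Q b) = ∑ i, ∑ j, a i * b j * (Pᵀ * Q) i j ^ 2 := by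
  rw [inner_conjDiag_left]
  refine Finset.sum_congr rfl fun i _ => ?_
  have : Pᵀ * (conjDiag Q b : Matrix ι ι ℝ) * P
      = (Pᵀ * Q) * Matrix.diagonal b * (Pᵀ * Q)ᵀ := by
    rw [coe_conjDiag, Matrix.transpose_mul, Matrix.transpose_transpose]
    simp only [Matrix.mul_assoc]
  rw [this, Matrix.mul_apply, Finset.mul_sum]
  refine Finset.sum_congr rfl fun j _ => ?_
  rw [Matrix.mul_diagonal, Matrix.transpose_apply]
  ring

theorem inner_conjDiag_self {Q : Matrix ι ι ℝ} (hQ : Q ∈ Matrix.orthogonalGroup ι ℝ)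
    (a b : ι → ℝ) : inner ℝ (conjDiag Q a) (conjDiag Q b) = ∑ i, a i * b i := by
  rw [inner_conjDiag, transpose_mul_self hQ]
  refine Finset.sum_congr rfl fun i _ => ?_
  rw [Finset.sum_eq_single i] <;> simp +contextual [eq_comm]

theorem inner_conjDiag_le {P Q : Matrix ι ι ℝ} (hP : P ∈ Matrix.orthogonalGroup ι ℝ)
    (hQ : Q ∈ Matrix.orthogonalGroup ι ℝ) {a b : ι → ℝ} (ha : Antitone a) (hb : Antitone b) :
    inner ℝ (conjDiag P a) (conjDiag Q b) ≤ ∑ i, a i * b i := by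
  rw [inner_conjDiag]
  exact sum_mul_sq_le_of_antitone ha hb (mul_mem (transpose_mem_orthogonalGroup hP) hQ)

theorem norm_conjDiag {Q : Matrix ι ι ℝ} (hQ : Q ∈ Matrix.orthogonalGroup ι ℝ)
    (a : EuclideanSpace ℝ ι) : ‖conjDiag Q a‖ = ‖a‖ := by
  rw [← sq_eq_sq₀ (norm_nonneg _) (norm_nonneg _), ← real_inner_self_eq_norm_sq,
    inner_conjDiag_self hQ, EuclideanSpace.real_norm_sq_eq]
  simp [pow_two]

end Trace

/-! ### Ordered eigenvalues -/

section Eig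

variable {ι : Type*} [Fintype ι] [LinearOrder ι]

theorem eig_antitone (A : symMat ι) : Antitone (eig A) := fun _ _ hij =>
  (symMat_isHermitian A).eigenvalues₀_antitone ((OrderIso.monotone _) hij)

/-- The ordered eigenvalues are a rearrangement of Mathlib's eigenvalues. -/
theorem exists_eig_eq_eigenvalues_comp (A : symMat ι) :
    ∃ τ : Equiv.Perm ι, ∀ i, eig A i = (symMat_isHermitian A).eigenvalues (τ i) := by
  refine ⟨(Fintype.orderIsoFinOfCardEq ι rfl).symm.toEquiv.trans
    (Fintype.equivOfCardEq (Fintype.card_fin _)), fun i => ?_⟩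
  simp [eig, Matrix.IsHermitian.eigenvalues]

theorem conjDiag_comp_perm (Q : Matrix ι ι ℝ) (a : ι → ℝ) (τ : Equiv.Perm ι) :
    conjDiag (Q.submatrix id τ) (a ∘ τ) = conjDiag Q a := by
  apply Subtype.ext
  ext i j
  rw [coe_conjDiag, coe_conjDiag, Matrix.mul_apply, Matrix.mul_apply]
  simp only [Matrix.mul_diagonal, Matrix.transpose_apply, Matrix.submatrix_apply, id,
    Function.comp_apply]
  exact Equiv.sum_comp τ fun k => Q i k * a k * Q j k

theorem submatrix_perm_mem_orthogonalGroup {Q : Matrix ι ι ℝ}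
    (hQ : Q ∈ Matrix.orthogonalGroup ι ℝ) (τ : Equiv.Perm ι) :
    Q.submatrix id τ ∈ Matrix.orthogonalGroup ι ℝ := by
  apply mem_orthogonalGroup_of_transpose_mul_self
  rw [Matrix.transpose_submatrix, ← Matrix.submatrix_mul _ _ _ _ _ Function.bijective_id,
    transpose_mul_self hQ, Matrix.submatrix_one_equiv]

theorem orthDiag_nonempty (A : symMat ι) : (orthDiag A).Nonempty := by
  obtain ⟨τ, hτ⟩ := exists_eig_eq_eigenvalues_comp A
  have hA := symMat_isHermitian A
  have hQ : (hA.eigenvectorUnitary : Matrix ι ι ℝ) ∈ Matrix.orthogonalGroup ι ℝ :=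
    hA.eigenvectorUnitary.2
  refine ⟨_, submatrix_perm_mem_orthogonalGroup hQ τ, ?_⟩
  have h1 : (eig A : ι → ℝ) = hA.eigenvalues ∘ τ := funext hτ
  have h2 := congrArg Subtype.val
    (conjDiag_comp_perm (hA.eigenvectorUnitary : Matrix ι ι ℝ) hA.eigenvalues τ)
  rw [coe_conjDiag, coe_conjDiag] at h2
  rw [h1, h2]
  conv_lhs => rw [hA.spectral_theorem]
  simp [Unitary.conjStarAlgAut_apply, Matrix.star_eq_conjTranspose]

theorem eq_of_inner_self_add_inner_self_le {E : Type*} [NormedAddCommGroup E]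
    [InnerProductSpace ℝ E] {x y : E} (h : inner ℝ x x + inner ℝ y y ≤ 2 * inner ℝ x y) :
    x = y := by
  have h1 := norm_sub_sq_real x y
  rw [real_inner_self_eq_norm_sq, real_inner_self_eq_norm_sq] at h
  rw [← sub_eq_zero, ← norm_eq_zero, ← sq_eq_zero_iff]
  exact le_antisymm (by linarith) (sq_nonneg _)

theorem eq_conjDiag_of_mem_orthDiag {A : symMat ι} {Q : Matrix ι ι ℝ} (hQ : Q ∈ orthDiag A) :
    A = conjDiag Q (eig A) := Subtype.ext hQ.2

theorem inner_self_eq_sum_eig (A : symMat ι) : inner ℝ A A = ∑ i, eig A i * eig A i := by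
  obtain ⟨Q, hQ⟩ := orthDiag_nonempty A
  conv_lhs => rw [eq_conjDiag_of_mem_orthDiag hQ]
  exact inner_conjDiag_self hQ.1 _ _

/-- The trace inequality of von Neumann and Fan. -/
theorem inner_le_sum_eig (A B : symMat ι) : inner ℝ A B ≤ ∑ i, eig A i * eig B i := by
  obtain ⟨P, hP⟩ := orthDiag_nonempty A
  obtain ⟨Q, hQ⟩ := orthDiag_nonempty B
  conv_lhs => rw [eq_conjDiag_of_mem_orthDiag hP, eq_conjDiag_of_mem_orthDiag hQ]
  exact inner_conjDiag_le hP.1 hQ.1 (eig_antitone A) (eig_antitone B)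

omit [LinearOrder ι] in
theorem sum_eq_inner (a b : EuclideanSpace ℝ ι) : ∑ i, a i * b i = inner ℝ a b := by
  simp [PiLp.inner_apply, mul_comm]

/-- Any ordered orthogonal diagonalization exhibits the ordered eigenvalues: by the trace
inequality `‖eig A - a‖² ≤ 2 ‖A‖² - 2 tr (A A) = 0`. -/
theorem eig_conjDiag {Q : Matrix ι ι ℝ} (hQ : Q ∈ Matrix.orthogonalGroup ι ℝ)
    {a : EuclideanSpace ℝ ι} (ha : Antitone a) : eig (conjDiag Q a) = a := by
  set A := conjDiag Q a with hA
  obtain ⟨P, hP⟩ := orthDiag_nonempty A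
  have h1 : inner ℝ A A = inner ℝ a a := by
    rw [hA, inner_conjDiag_self hQ, sum_eq_inner]
  have h2 : inner ℝ A A = inner ℝ (eig A) (eig A) := by
    rw [inner_self_eq_sum_eig, sum_eq_inner]
  have h3 : inner ℝ A A ≤ inner ℝ (eig A) a := by
    rw [← sum_eq_inner]
    nth_rewrite 1 [eq_conjDiag_of_mem_orthDiag hP]
    exact inner_conjDiag_le hP.1 hQ (eig_antitone A) ha
  exact eq_of_inner_self_add_inner_self_le (by linarith)

theorem norm_eig_sub_eig_le (A B : symMat ι) : ‖eig A - eig B‖ ≤ ‖A - B‖ := by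
  rw [← sq_le_sq₀ (norm_nonneg _) (norm_nonneg _), norm_sub_sq_real, norm_sub_sq_real]
  have h := inner_le_sum_eig A B
  have hA := inner_self_eq_sum_eig A
  have hB := inner_self_eq_sum_eig B
  rw [sum_eq_inner, real_inner_self_eq_norm_sq] at hA hB
  rw [sum_eq_inner] at h
  rw [real_inner_self_eq_norm_sq] at hA hB
  linarith

/-- Equality in the trace inequality gives a common ordered diagonalization. Any matrix that
diagonalizes `C = A + B` serves: the equality forces `eig C = eig A + eig B`, and then it turns the
trace inequality between `A` and `Q Diag(eig A) Qᵀ` into an equality as well. -/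
theorem orthDiag_inter_nonempty_of_inner_eq {A B : symMat ι}
    (h : inner ℝ A B = ∑ i, eig A i * eig B i) : (orthDiag A ∩ orthDiag B).Nonempty := by
  obtain ⟨Q, hQ⟩ := orthDiag_nonempty (A + B)
  have hA := inner_self_eq_sum_eig A
  have hB := inner_self_eq_sum_eig B
  have hC := inner_self_eq_sum_eig (A + B)
  have hCA := inner_le_sum_eig (A + B) A
  have hCB := inner_le_sum_eig (A + B) B
  rw [sum_eq_inner] at h hA hB hC hCA hCB
  have hsum : eig (A + B) = eig A + eig B := by
    have h1 := real_inner_comm A B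
    have h2 := real_inner_comm (eig A) (eig B)
    rw [inner_add_left] at hCA hCB
    rw [inner_add_left, inner_add_right, inner_add_right] at hC
    apply eq_of_inner_self_add_inner_self_le
    rw [inner_add_right, inner_add_right, inner_add_left, inner_add_left]
    linarith
  have hsplit : A + B = conjDiag Q (eig A) + conjDiag Q (eig B) := by
    rw [← conjDiag_add]
    nth_rewrite 1 [eq_conjDiag_of_mem_orthDiag hQ]
    rw [hsum]
    rfl
  have hle : ∀ D E : symMat ι, inner ℝ D (conjDiag Q (eig E)) ≤ inner ℝ (eig D) (eig E) := by
    intro D E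
    have := inner_le_sum_eig D (conjDiag Q (eig E))
    rwa [eig_conjDiag hQ.1 (eig_antitone E), sum_eq_inner] at this
  have hnorm : ∀ D : symMat ι, inner ℝ (conjDiag Q (eig D)) (conjDiag Q (eig D))
      = inner ℝ (eig D) (eig D) := by
    intro D
    rw [inner_conjDiag_self hQ.1, sum_eq_inner]
  have key : ∀ D E : symMat ι, inner ℝ D D + inner ℝ D E
      = inner ℝ D (conjDiag Q (eig D)) + inner ℝ D (conjDiag Q (eig E)) →
      inner ℝ D D = inner ℝ (eig D) (eig D) → inner ℝ D E = inner ℝ (eig D) (eig E) →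
      D = conjDiag Q (eig D) := by
    intro D E h1 h2 h3
    have h4 := hle D E
    have h5 := hnorm D
    exact eq_of_inner_self_add_inner_self_le (by linarith)
  have hAQ : A = conjDiag Q (eig A) := by
    refine key A B ?_ hA h
    rw [← inner_add_right, hsplit, inner_add_right]
  have hBQ : B = conjDiag Q (eig B) := by
    refine key B A ?_ hB (by rw [real_inner_comm, h, real_inner_comm])
    rw [← inner_add_right, add_comm B A, hsplit, inner_add_right, add_comm]
  exact ⟨Q, ⟨hQ.1, congrArg Subtype.val hAQ⟩, ⟨hQ.1, congrArg Subtype.val hBQ⟩⟩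

theorem inner_eq_sum_eig_of_mem_orthDiag {A B : symMat ι} {Q : Matrix ι ι ℝ}
    (hA : Q ∈ orthDiag A) (hB : Q ∈ orthDiag B) : inner ℝ A B = ∑ i, eig A i * eig B i := by
  conv_lhs => rw [eq_conjDiag_of_mem_orthDiag hA, eq_conjDiag_of_mem_orthDiag hB]
  exact inner_conjDiag_self hA.1 _ _

theorem transpose_mul_mul_eq_diagonal_iff {A : symMat ι} {Q : Matrix ι ι ℝ}
    (hQ : Q ∈ Matrix.orthogonalGroup ι ℝ) :
    Qᵀ * (A : Matrix ι ι ℝ) * Q = Matrix.diagonal (eig A) ↔ Q ∈ orthDiag A := by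
  have h1 := transpose_mul_self hQ
  have h2 := mul_transpose_self hQ
  constructor
  · intro h
    refine ⟨hQ, ?_⟩
    rw [← h]
    simp only [Matrix.mul_assoc]
    rw [h2, Matrix.mul_one, ← Matrix.mul_assoc, h2, Matrix.one_mul]
  · intro h
    conv_lhs => rw [h.2]
    simp only [Matrix.mul_assoc]
    rw [h1, Matrix.mul_one, ← Matrix.mul_assoc, h1, Matrix.one_mul]

theorem hasSimOrdSpectralDecomp_iff_inner_eq (A B : symMat ι) :
    HasSimOrdSpectralDecomp A B ↔ inner ℝ A B = ∑ i, eig A i * eig B i := by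
  constructor
  · rintro ⟨Q, hQ, hA, hB⟩
    exact inner_eq_sum_eig_of_mem_orthDiag ((transpose_mul_mul_eq_diagonal_iff hQ).1 hA)
      ((transpose_mul_mul_eq_diagonal_iff hQ).1 hB)
  · intro h
    obtain ⟨Q, hA, hB⟩ := orthDiag_inter_nonempty_of_inner_eq h
    exact ⟨Q, hA.1, (transpose_mul_mul_eq_diagonal_iff hA.1).2 hA,
      (transpose_mul_mul_eq_diagonal_iff hA.1).2 hB⟩

theorem spectrum_eq_range_eig (A : symMat ι) :
    spectrum ℝ (A : Matrix ι ι ℝ) = Set.range (eig A) := by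
  obtain ⟨τ, hτ⟩ := exists_eig_eq_eigenvalues_comp A
  rw [(symMat_isHermitian A).spectrum_real_eq_range_eigenvalues,
    show (eig A : ι → ℝ) = (symMat_isHermitian A).eigenvalues ∘ τ from funext hτ,
    EquivLike.range_comp]

end Eig

/-! ### Compression to the eigenspaces -/

section Block

variable {ι : Type*} [Fintype ι] [LinearOrder ι]

theorem mem_eigIndex {X : symMat ι} {c : ℝ} {i : ι} : i ∈ eigIndex X c ↔ eig X i = c := by
  simp [eigIndex]

theorem eigDiagBlock_eq_conjDiag (Y : symMat ι) (s : Finset ι) :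
    eigDiagBlock Y s = conjDiag 1 (fun i : s => eig Y i) := by
  apply Subtype.ext
  rw [coe_conjDiag, Matrix.one_mul, Matrix.transpose_one, Matrix.mul_one]
  exact Matrix.submatrix_diagonal _ _ Subtype.val_injective

omit [Fintype ι] in
theorem eig_conjDiag_one_restrict {y : ι → ℝ} (hy : Antitone y) (s : Finset ι) (i : s) :
    eig (conjDiag 1 (fun i : s => y i)) i = y i := by
  have h : eig (conjDiag 1 (fun i : s => y i)) = WithLp.toLp 2 fun i : s => y i :=
    eig_conjDiag (a := WithLp.toLp 2 fun i : s => y i) (one_mem _) fun i j hij => hy hij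
  rw [h]

theorem sum_eigIndex (X : symMat ι) (f : ι → ℝ) :
    ∑ c ∈ Finset.univ.image (eig X), ∑ i : eigIndex X c, f i = ∑ i, f i := by
  rw [← Finset.sum_fiberwise_of_maps_to (s := Finset.univ) (t := Finset.univ.image (eig X))
    (g := eig X) (fun i hi => Finset.mem_image_of_mem _ hi)]
  exact Finset.sum_congr rfl fun c _ => Finset.sum_coe_sort (eigIndex X c) f

theorem inner_conjDiag_eq_sum_blocks (X H : symMat ι) (V : Matrix ι ι ℝ) (y : ι → ℝ) :
    inner ℝ (conjDiag V y) H = ∑ c ∈ Finset.univ.image (eig X),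
      inner ℝ (conjDiag 1 fun i : eigIndex X c => y i) (colCompression V (eigIndex X c) H) := by
  rw [inner_conjDiag_left, ← sum_eigIndex X]
  refine Finset.sum_congr rfl fun c _ => ?_
  rw [inner_conjDiag_left]
  refine Finset.sum_congr rfl fun i _ => ?_
  rw [Matrix.transpose_one, Matrix.one_mul, Matrix.mul_one]
  rfl

theorem colCompression_mul {X : symMat ι} {W : Matrix ι ι ℝ}
    (hW : ∀ k j, eig X k ≠ eig X j → W k j = 0) (U : Matrix ι ι ℝ) (c : ℝ) (H : symMat ι) :
    (colCompression (U * W) (eigIndex X c) H : Matrix (eigIndex X c) (eigIndex X c) ℝ) =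
      (W.submatrix Subtype.val Subtype.val)ᵀ *
        (colCompression U (eigIndex X c) H : Matrix (eigIndex X c) (eigIndex X c) ℝ) *
        W.submatrix Subtype.val Subtype.val := by
  have h : (U * W).submatrix id (Subtype.val : eigIndex X c → ι) =
      U.submatrix id (Subtype.val : eigIndex X c → ι) *
        W.submatrix (Subtype.val : eigIndex X c → ι) Subtype.val := by
    ext i j
    simp only [Matrix.submatrix_apply, Matrix.mul_apply, id]
    rw [Finset.sum_coe_sort (eigIndex X c) fun k => U i k * W k j]
    refine (Finset.sum_subset (Finset.subset_univ _) fun k _ hk => ?_).symm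
    rw [hW k j, mul_zero]
    rw [mem_eigIndex.1 j.2]
    exact fun h => hk (mem_eigIndex.2 h)
  simp only [colCompression, h, Matrix.transpose_mul, Matrix.mul_assoc]

/-- Two ordered diagonalizations of `X` differ by an orthogonal matrix that commutes with
`Diag(eig X)`, hence does not mix different eigenspaces. -/
theorem transpose_mul_apply_eq_zero {X : symMat ι} {U V : Matrix ι ι ℝ} (hU : U ∈ orthDiag X)
    (hV : V ∈ orthDiag X) {k j : ι} (h : eig X k ≠ eig X j) : (Uᵀ * V) k j = 0 := by
  have h1 : Matrix.diagonal (eig X) * (Uᵀ * V) = (Uᵀ * V) * Matrix.diagonal (eig X) := by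
    have h2 := mul_transpose_self hU.1
    have h3 := mul_transpose_self hV.1
    calc Matrix.diagonal (eig X) * (Uᵀ * V) = Uᵀ * (X : Matrix ι ι ℝ) * (U * Uᵀ) * V := by
          rw [← (transpose_mul_mul_eq_diagonal_iff hU.1).2 hU]
          simp only [Matrix.mul_assoc]
      _ = Uᵀ * (V * Vᵀ) * X * V := by rw [h2, h3, Matrix.mul_one, Matrix.mul_one]
      _ = Uᵀ * V * Matrix.diagonal (eig X) := by
          rw [← (transpose_mul_mul_eq_diagonal_iff hV.1).2 hV]
          simp only [Matrix.mul_assoc]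
  have h2 := congrFun (congrFun h1 k) j
  rw [Matrix.diagonal_mul, Matrix.mul_diagonal] at h2
  have h3 : (eig X k - eig X j) * (Uᵀ * V) k j = 0 := by linarith
  exact (mul_eq_zero.1 h3).resolve_left (sub_ne_zero.2 h)

theorem submatrix_mem_orthogonalGroup {X : symMat ι} {W : Matrix ι ι ℝ}
    (hW : ∀ k j, eig X k ≠ eig X j → W k j = 0) (hWo : W ∈ Matrix.orthogonalGroup ι ℝ) (c : ℝ) :
    W.submatrix Subtype.val Subtype.val ∈ Matrix.orthogonalGroup (eigIndex X c) ℝ := by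
  apply mem_orthogonalGroup_of_transpose_mul_self
  ext i j
  have h := congrFun (congrFun (transpose_mul_self hWo) i) j
  rw [Matrix.mul_apply] at h ⊢
  simp only [Matrix.transpose_apply, Matrix.submatrix_apply] at h ⊢
  rw [Finset.sum_coe_sort (eigIndex X c) fun k => W k i * W k j,
    Finset.sum_subset (Finset.subset_univ _), h]
  · simp [Matrix.one_apply]
  · intro k _ hk
    rw [hW k j, mul_zero]
    rw [mem_eigIndex.1 j.2]
    exact fun h => hk (mem_eigIndex.2 h)

theorem eig_eq_of_eq_transpose_mul_mul {A B : symMat ι} {W : Matrix ι ι ℝ}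
    (hW : W ∈ Matrix.orthogonalGroup ι ℝ)
    (h : (A : Matrix ι ι ℝ) = Wᵀ * (B : Matrix ι ι ℝ) * W) : eig A = eig B := by
  obtain ⟨P, hP⟩ := orthDiag_nonempty B
  have hA : A = conjDiag (Wᵀ * P) (eig B) := by
    apply Subtype.ext
    rw [h, coe_conjDiag, Matrix.transpose_mul, Matrix.transpose_transpose]
    calc Wᵀ * (B : Matrix ι ι ℝ) * W = Wᵀ * (P * Matrix.diagonal (eig B) * Pᵀ) * W := by
          rw [← hP.2]
      _ = _ := by simp only [Matrix.mul_assoc]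
  rw [hA, eig_conjDiag (mul_mem (transpose_mem_orthogonalGroup hW) hP.1) (eig_antitone B)]

theorem eig_colCompression_eq {X : symMat ι} {U V : Matrix ι ι ℝ} (hU : U ∈ orthDiag X)
    (hV : V ∈ orthDiag X) (c : ℝ) (H : symMat ι) :
    eig (colCompression V (eigIndex X c) H) = eig (colCompression U (eigIndex X c) H) := by
  have hW : ∀ k j, eig X k ≠ eig X j → (Uᵀ * V) k j = 0 := fun k j h =>
    transpose_mul_apply_eq_zero hU hV h
  have hWo := mul_mem (transpose_mem_orthogonalGroup hU.1) hV.1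
  refine eig_eq_of_eq_transpose_mul_mul (submatrix_mem_orthogonalGroup hW hWo c) ?_
  rw [← colCompression_mul hW, ← Matrix.mul_assoc, mul_transpose_self hU.1, Matrix.one_mul]

/-- The sum, over the eigenvalues `c` of `X`, of the pairings of the restriction of `y` to the
positions of `c` with the ordered eigenvalues of the compression of `H` to the eigenspace of `c`,
where the columns of `U` are eigenvectors of `X`. For antitone `y` it is the derivative of
`⟨y, eig ·⟩` at `X` in the direction `H`. -/
def blockPairing (X : symMat ι) (U : Matrix ι ι ℝ) (H : symMat ι) (y : ι → ℝ) : ℝ :=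
  ∑ c ∈ Finset.univ.image (eig X),
    ∑ i : eigIndex X c, y i * eig (colCompression U (eigIndex X c) H) i

omit [Fintype ι] in
theorem inner_block_le {y : ι → ℝ} (hy : Antitone y) {s : Finset ι} (B : symMat s) :
    inner ℝ (conjDiag 1 fun i : s => y i) B ≤ ∑ i : s, y i * eig B i := by
  refine (inner_le_sum_eig _ _).trans_eq ?_
  simp_rw [eig_conjDiag_one_restrict hy]

theorem inner_conjDiag_le_blockPairing {X : symMat ι} {U V : Matrix ι ι ℝ} (hU : U ∈ orthDiag X)
    (hV : V ∈ orthDiag X) (H : symMat ι) {y : ι → ℝ} (hy : Antitone y) :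
    inner ℝ (conjDiag V y) H ≤ blockPairing X U H y := by
  rw [inner_conjDiag_eq_sum_blocks X]
  refine Finset.sum_le_sum fun c _ => ?_
  rw [← eig_colCompression_eq hU hV]
  exact inner_block_le hy _

/-- The bound `inner_conjDiag_le_blockPairing` is attained: rotate the columns of `U` inside each
eigenspace of `X` so that the compressions of `H` become diagonal and ordered. -/
theorem exists_inner_conjDiag_eq_blockPairing {X : symMat ι} {U : Matrix ι ι ℝ}
    (hU : U ∈ orthDiag X) (H : symMat ι) (y : ι → ℝ) :
    ∃ V ∈ orthDiag X, inner ℝ (conjDiag V y) H = blockPairing X U H y := by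
  choose Q hQ using fun c => orthDiag_nonempty (colCompression U (eigIndex X c) H)
  let W : Matrix ι ι ℝ := fun k j => if h : eig X k = eig X j then
    Q (eig X j) ⟨k, mem_eigIndex.2 h⟩ ⟨j, mem_eigIndex.2 rfl⟩ else 0
  have hW : ∀ k j, eig X k ≠ eig X j → W k j = 0 := fun k j h => dif_neg h
  have hWQ : ∀ c, W.submatrix Subtype.val Subtype.val = Q c := by
    intro c
    ext ⟨k, hk⟩ ⟨j, hj⟩
    obtain rfl := mem_eigIndex.1 hj
    exact dif_pos (mem_eigIndex.1 hk)
  have hWo : W ∈ Matrix.orthogonalGroup ι ℝ := by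
    apply mem_orthogonalGroup_of_transpose_mul_self
    ext i j
    rw [Matrix.mul_apply]
    simp only [Matrix.transpose_apply]
    by_cases hij : eig X i = eig X j
    · rw [← Finset.sum_subset (Finset.subset_univ (eigIndex X (eig X j))) fun k _ hk => by
          rw [hW k j fun h => hk (mem_eigIndex.2 h), mul_zero],
        ← Finset.sum_coe_sort (eigIndex X (eig X j)) fun k => W k i * W k j]
      have h := congrFun (congrFun (transpose_mul_self (hQ (eig X j)).1)
        ⟨i, mem_eigIndex.2 hij⟩) ⟨j, mem_eigIndex.2 rfl⟩
      rw [← hWQ, Matrix.mul_apply] at h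
      simpa [Matrix.one_apply] using h
    · rw [Matrix.one_apply_ne fun h => hij (congrArg (eig X) h)]
      refine Finset.sum_eq_zero fun k _ => ?_
      by_cases hk : eig X k = eig X i
      · rw [hW k j (hk ▸ hij), mul_zero]
      · rw [hW k i hk, zero_mul]
  have hcomm : W * Matrix.diagonal (eig X) = Matrix.diagonal (eig X) * W := by
    ext k j
    rw [Matrix.mul_diagonal, Matrix.diagonal_mul]
    by_cases h : eig X k = eig X j
    · rw [h, mul_comm]
    · rw [hW k j h, zero_mul, mul_zero]
  refine ⟨U * W, ⟨mul_mem hU.1 hWo, ?_⟩, ?_⟩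
  · calc (X : Matrix ι ι ℝ) = U * (Matrix.diagonal (eig X) * (W * Wᵀ)) * Uᵀ := by
          rw [mul_transpose_self hWo, Matrix.mul_one, ← hU.2]
      _ = U * W * Matrix.diagonal (eig X) * (U * W)ᵀ := by
          rw [← Matrix.mul_assoc (Matrix.diagonal _), ← hcomm, Matrix.transpose_mul]
          simp only [Matrix.mul_assoc]
  · rw [inner_conjDiag_eq_sum_blocks X]
    refine Finset.sum_congr rfl fun c _ => ?_
    rw [inner_conjDiag_left, colCompression_mul hW, hWQ,
      (transpose_mul_mul_eq_diagonal_iff (hQ c).1).2 (hQ c)]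
    simp

end Block

/-! ### Directional derivatives of the ordered eigenvalues -/

section Derivative

variable {ι : Type*} [Fintype ι] [LinearOrder ι]

theorem exists_tendsto_orthogonal {α : Type*} (𝒰 : Ultrafilter α) {Q : α → Matrix ι ι ℝ}
    (hQ : ∀ t, Q t ∈ Matrix.orthogonalGroup ι ℝ) :
    ∃ V ∈ Matrix.orthogonalGroup ι ℝ, Tendsto Q 𝒰 (𝓝 V) := by
  have h : ∀ i j, ∃ v : ℝ, Tendsto (fun t => Q t i j) 𝒰 (𝓝 v) := by
    intro i j
    obtain ⟨v, -, hv⟩ := (isCompact_Icc (a := (-1 : ℝ)) (b := 1)).ultrafilter_le_nhds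
      (𝒰.map fun t => Q t i j) (by
        rw [le_principal_iff, Ultrafilter.coe_map, Filter.mem_map]
        exact Eventually.of_forall fun t => abs_le.1 (abs_entry_le_one (hQ t) i j))
    exact ⟨v, hv⟩
  choose v hV using h
  let V : Matrix ι ι ℝ := Matrix.of v
  have hlim : Tendsto Q 𝒰 (𝓝 V) :=
    tendsto_pi_nhds.2 fun i => tendsto_pi_nhds.2 fun j => hV i j
  refine ⟨V, mem_orthogonalGroup_of_transpose_mul_self ?_, hlim⟩
  have hc : Continuous fun M : Matrix ι ι ℝ => Mᵀ * M := by fun_prop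
  have h1 : Tendsto (fun t => (Q t)ᵀ * Q t) 𝒰 (𝓝 (Vᵀ * V)) :=
    (hc.tendsto V).comp hlim
  simp_rw [transpose_mul_self (hQ _)] at h1
  exact tendsto_nhds_unique h1 tendsto_const_nhds

theorem tendsto_eig {α : Type*} {l : Filter α} {A : α → symMat ι} {B : symMat ι}
    (h : Tendsto A l (𝓝 B)) : Tendsto (fun t => eig (A t)) l (𝓝 (eig B)) := by
  have h' := tendsto_iff_norm_sub_tendsto_zero.1 h
  exact tendsto_iff_norm_sub_tendsto_zero.2
    (squeeze_zero (fun _ => norm_nonneg _) (fun t => norm_eig_sub_eig_le _ _) h')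

omit [LinearOrder ι] in
theorem inner_add_smul_right (Z X H : symMat ι) (t : ℝ) :
    inner ℝ Z (X + t • H) = inner ℝ Z X + t * inner ℝ Z H := by
  rw [inner_add_right]
  exact congrArg _ (real_inner_smul_right Z H t)

/-- The directional derivative of the support function `⟨y, eig ·⟩ = max ⟨U Diag(y) Uᵀ, ·⟩`. The
difference quotients are bounded below by `⟨V Diag(y) Vᵀ, H⟩` for any diagonalization `V` of `X`,
and above by `⟨U Diag(y) Uᵀ, H⟩` for a diagonalization `U` of `X + t H`; by compactness these
accumulate only at diagonalizations of `X`. -/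
theorem tendsto_slope_inner_eig {X : symMat ι} {U : Matrix ι ι ℝ} (hU : U ∈ orthDiag X)
    (H : symMat ι) {y : ι → ℝ} (hy : Antitone y) :
    Tendsto (fun t : ℝ => t⁻¹ * (∑ i, y i * eig (X + t • H) i - ∑ i, y i * eig X i)) (𝓝[>] 0)
      (𝓝 (blockPairing X U H y)) := by
  have hlow : ∀ t : ℝ, 0 < t → blockPairing X U H y ≤
      t⁻¹ * (∑ i, y i * eig (X + t • H) i - ∑ i, y i * eig X i) := by
    intro t ht
    obtain ⟨V, hV, hVH⟩ := exists_inner_conjDiag_eq_blockPairing hU H y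
    rw [← hVH, ← div_eq_inv_mul, le_div_iff₀ ht]
    obtain ⟨P, hP⟩ := orthDiag_nonempty (X + t • H)
    have h1 : inner ℝ (conjDiag V y) (X + t • H) ≤ ∑ i, y i * eig (X + t • H) i := by
      nth_rewrite 1 [eq_conjDiag_of_mem_orthDiag hP]
      exact inner_conjDiag_le hV.1 hP.1 hy (eig_antitone _)
    have h2 : inner ℝ (conjDiag V y) X = ∑ i, y i * eig X i := by
      nth_rewrite 1 [eq_conjDiag_of_mem_orthDiag hV]
      exact inner_conjDiag_self hV.1 _ _
    rw [inner_add_smul_right, h2] at h1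
    linarith
  choose Q hQ using fun t : ℝ => orthDiag_nonempty (X + t • H)
  have hup : ∀ t : ℝ, 0 < t →
      t⁻¹ * (∑ i, y i * eig (X + t • H) i - ∑ i, y i * eig X i) ≤ inner ℝ (conjDiag (Q t) y) H := by
    intro t ht
    rw [← div_eq_inv_mul, div_le_iff₀ ht]
    have h1 : inner ℝ (conjDiag (Q t) y) (X + t • H) = ∑ i, y i * eig (X + t • H) i := by
      nth_rewrite 1 [eq_conjDiag_of_mem_orthDiag (hQ t)]
      exact inner_conjDiag_self (hQ t).1 _ _
    have h2 : inner ℝ (conjDiag (Q t) y) X ≤ ∑ i, y i * eig X i := by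
      nth_rewrite 1 [eq_conjDiag_of_mem_orthDiag hU]
      exact inner_conjDiag_le (hQ t).1 hU.1 hy (eig_antitone _)
    rw [inner_add_smul_right] at h1
    linarith
  rw [tendsto_iff_ultrafilter]
  intro 𝒰 h𝒰
  have hpos : ∀ᶠ t in (𝒰 : Filter ℝ), 0 < t := h𝒰 self_mem_nhdsWithin
  have h0 : Tendsto (fun t : ℝ => t) 𝒰 (𝓝 0) := h𝒰.trans nhdsWithin_le_nhds
  obtain ⟨V, hVo, hV⟩ := exists_tendsto_orthogonal 𝒰 fun t => (hQ t).1
  have hX : Tendsto (fun t : ℝ => X + t • H) 𝒰 (𝓝 X) := by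
    simpa using tendsto_const_nhds.add (h0.smul_const H)
  have hcont : Continuous fun p : Matrix ι ι ℝ × EuclideanSpace ℝ ι =>
      p.1 * Matrix.diagonal p.2 * p.1ᵀ := by fun_prop
  have hVX : V ∈ orthDiag X := by
    refine ⟨hVo, tendsto_nhds_unique ((continuous_subtype_val.tendsto X).comp hX) ?_⟩
    refine ((hcont.tendsto (V, eig X)).comp (hV.prodMk_nhds (tendsto_eig hX))).congr fun t => ?_
    exact (hQ t).2.symm
  have hlim : Tendsto (fun t => inner ℝ (conjDiag (Q t) y) H) 𝒰 (𝓝 (inner ℝ (conjDiag V y) H)) := by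
    have hc : Continuous fun M : Matrix ι ι ℝ => (M * Matrix.diagonal y * Mᵀ * H).trace := by
      fun_prop
    exact (hc.tendsto V).comp hV
  rw [tendsto_order]
  constructor
  · intro a ha
    filter_upwards [hpos] with t ht using ha.trans_le (hlow t ht)
  · intro a ha
    filter_upwards [hpos, hlim.eventually_lt_const
      ((inner_conjDiag_le_blockPairing hU hVX H hy).trans_lt ha)] with t ht hlt
    exact (hup t ht).trans_lt hlt

/-- Each coordinate is the difference of two pairings with antitone vectors, namely the indicators
of the initial segments `{j | j ≤ i}` and `{j | j < i}`. -/
theorem hasDirDeriv_eig (X H : symMat ι) : HasDirDeriv eig X H (dirDeriv eig X H) := by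
  obtain ⟨U, hU⟩ := orthDiag_nonempty X
  have hcoord : ∀ i, ∃ d : ℝ, Tendsto (fun t : ℝ => t⁻¹ * (eig (X + t • H) i - eig X i))
      (𝓝[>] 0) (𝓝 d) := by
    intro i
    have h1 : Antitone fun j => if j ≤ i then (1 : ℝ) else 0 := fun j k hjk => by
      dsimp only
      split_ifs with h h' <;> first | exact absurd (hjk.trans h) h' | norm_num
    have h2 : Antitone fun j => if j < i then (1 : ℝ) else 0 := fun j k hjk => by
      dsimp only
      split_ifs with h h' <;> first | exact absurd (hjk.trans_lt h) h' | norm_num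
    refine ⟨_, ((tendsto_slope_inner_eig hU H h1).sub (tendsto_slope_inner_eig hU H h2)).congr
      fun t => ?_⟩
    have hs : ∀ z : EuclideanSpace ℝ ι, (∑ j, (if j ≤ i then (1 : ℝ) else 0) * z j)
        = (∑ j, (if j < i then (1 : ℝ) else 0) * z j) + z i := by
      intro z
      rw [← sub_eq_iff_eq_add', ← Finset.sum_sub_distrib, Finset.sum_eq_single i]
      · simp
      · intro j _ hj
        simp [le_iff_lt_or_eq, hj]
      · simp
    rw [hs, hs]
    ring
  choose d hd using hcoord
  have hex : HasDirDeriv eig X H (WithLp.toLp 2 d) := by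
    have h := (PiLp.continuous_toLp 2 fun _ : ι => ℝ).tendsto d
    refine (h.comp (tendsto_pi_nhds.2 hd)).congr fun t => ?_
    ext i
    simp
  exact tendsto_nhds_limUnder ⟨_, hex⟩

theorem sum_mul_dirDeriv_eig {X : symMat ι} {U : Matrix ι ι ℝ} (hU : U ∈ orthDiag X)
    (H : symMat ι) {y : ι → ℝ} (hy : Antitone y) :
    ∑ i, y i * dirDeriv eig X H i = blockPairing X U H y := by
  refine tendsto_nhds_unique ?_ (tendsto_slope_inner_eig hU H hy)
  have hc : Continuous fun z : EuclideanSpace ℝ ι => ∑ i, y i * z i := by fun_prop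
  refine ((hc.tendsto _).comp (hasDirDeriv_eig X H)).congr fun t => ?_
  simp only [Function.comp_apply, PiLp.smul_apply, PiLp.sub_apply, smul_eq_mul]
  rw [← Finset.sum_sub_distrib, Finset.mul_sum]
  exact Finset.sum_congr rfl fun i _ => by ring

/-- The trace inequality in each eigenspace of `X` bounds `⟨Y, H⟩` by
`⟨eig Y, dirDeriv eig X H⟩`, with equality exactly if every block is an equality case. -/
theorem inner_le_inner_dirDeriv_eig {X Y : symMat ι}
    {U : Matrix ι ι ℝ} (hX : U ∈ orthDiag X) (hY : U ∈ orthDiag Y) (H : symMat ι) :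
    inner ℝ Y H ≤ inner ℝ (eig Y) (dirDeriv eig X H) ∧
      (inner ℝ Y H = inner ℝ (eig Y) (dirDeriv eig X H) ↔
        ∀ i, HasSimOrdSpectralDecomp (eigDiagBlock Y (eigIndex X (eig X i)))
          (colCompression U (eigIndex X (eig X i)) H)) := by
  rw [← sum_eq_inner, sum_mul_dirDeriv_eig hX H (eig_antitone Y)]
  have hYU : inner ℝ Y H = inner ℝ (conjDiag U (eig Y)) H :=
    congrArg (inner ℝ · H) (eq_conjDiag_of_mem_orthDiag hY)
  rw [hYU]
  refine ⟨inner_conjDiag_le_blockPairing hX hX H (eig_antitone Y), ?_⟩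
  rw [inner_conjDiag_eq_sum_blocks X, blockPairing,
    Finset.sum_eq_sum_iff_of_le fun c _ => inner_block_le (eig_antitone Y) _]
  simp only [Finset.mem_image, Finset.mem_univ, true_and, forall_exists_index,
    forall_apply_eq_imp_iff]
  refine forall_congr' fun i => ?_
  rw [hasSimOrdSpectralDecomp_iff_inner_eq, eigDiagBlock_eq_conjDiag]
  simp_rw [eig_conjDiag_one_restrict (eig_antitone Y)]

end Derivative

/-! ### Subderivatives -/

section Subderivative

variable {E F : Type*} [NormedAddCommGroup E] [InnerProductSpace ℝ E]
  [NormedAddCommGroup F] [InnerProductSpace ℝ F]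

theorem inner_le_subderivative {f : E → EReal} {x v : E} (hv : v ∈ subdifferential f x) (w : E) :
    ((inner ℝ v w : ℝ) : EReal) ≤ subderivative f x w := by
  obtain ⟨hbot, htop, hsub⟩ := hv
  have hlim : Tendsto (fun p : ℝ × E => ((inner ℝ v p.2 : ℝ) : EReal)) (𝓝[>] (0 : ℝ) ×ˢ 𝓝 w)
      (𝓝 ((inner ℝ v w : ℝ) : EReal)) :=
    (continuous_coe_real_ereal.tendsto _).comp
      (((continuous_const.inner continuous_id).tendsto w).comp tendsto_snd)
  rw [← hlim.liminf_eq]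
  refine liminf_le_liminf ?_
  filter_upwards [tendsto_fst.eventually (self_mem_nhdsWithin (a := (0 : ℝ)) (s := Set.Ioi 0))]
    with p hp
  have hp : 0 < p.1 := hp
  rw [EReal.le_div_iff_mul_le (by exact_mod_cast hp) (EReal.coe_ne_top _)]
  have h := hsub (x + p.1 • p.2)
  rw [add_sub_cancel_left, real_inner_smul_right] at h
  rw [EReal.le_sub_iff_add_le (Or.inl hbot) (Or.inl htop), add_comm, ← EReal.coe_mul, mul_comm]
  exact h

/-- For a nonexpansive map the difference quotients converge uniformly in the direction. -/
theorem tendsto_slope_of_hasDirDeriv {f : E → F} (hf : ∀ a b, ‖f a - f b‖ ≤ ‖a - b‖) {x w : E}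
    {d : F} (hd : HasDirDeriv f x w d) :
    Tendsto (fun p : ℝ × E => p.1⁻¹ • (f (x + p.1 • p.2) - f x)) (𝓝[>] (0 : ℝ) ×ˢ 𝓝 w)
      (𝓝 d) := by
  have hd : Tendsto (fun t : ℝ => t⁻¹ • (f (x + t • w) - f x)) (𝓝[>] 0) (𝓝 d) := hd
  have hlim : Tendsto (fun p : ℝ × E => ‖p.2 - w‖ + ‖p.1⁻¹ • (f (x + p.1 • w) - f x) - d‖)
      (𝓝[>] (0 : ℝ) ×ˢ 𝓝 w) (𝓝 0) := by
    have h1 : Tendsto (fun p : ℝ × E => ‖p.2 - w‖) (𝓝[>] (0 : ℝ) ×ˢ 𝓝 w) (𝓝 0) :=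
      tendsto_iff_norm_sub_tendsto_zero.1 tendsto_snd
    simpa using h1.add ((tendsto_iff_norm_sub_tendsto_zero.1 hd).comp tendsto_fst)
  refine tendsto_iff_norm_sub_tendsto_zero.2
    (squeeze_zero' (Eventually.of_forall fun _ => norm_nonneg _) ?_ hlim)
  filter_upwards [tendsto_fst.eventually
    (self_mem_nhdsWithin (a := (0 : ℝ)) (s := Set.Ioi 0))] with p hp
  have hp : 0 < p.1 := hp
  have h1 : p.1⁻¹ • (f (x + p.1 • p.2) - f x) - d =
      p.1⁻¹ • (f (x + p.1 • p.2) - f (x + p.1 • w)) +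
        (p.1⁻¹ • (f (x + p.1 • w) - f x) - d) := by
    rw [← add_sub_assoc, ← smul_add, sub_add_sub_cancel]
  have h2 : ‖p.1⁻¹ • (f (x + p.1 • p.2) - f (x + p.1 • w))‖ ≤ ‖p.2 - w‖ := by
    have h3 := hf (x + p.1 • p.2) (x + p.1 • w)
    rw [add_sub_add_left_eq_sub, ← smul_sub, norm_smul, Real.norm_of_nonneg hp.le] at h3
    rw [norm_smul, norm_inv, Real.norm_of_nonneg hp.le, ← div_eq_inv_mul, div_le_iff₀ hp,
      mul_comm]
    exact h3
  rw [h1]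
  exact (norm_add_le _ _).trans (by gcongr)

/-- Monotonicity of subderivatives under a change of variables: if the values of `f` along
`x + t w'` are values of `h` along `y + t (ψ (t, w'))` with `ψ` converging to `z`, then every
difference quotient of `f` competes in the lower limit for `h`. -/
theorem subderivative_le_subderivative {f : E → EReal} {h : F → EReal} {x w : E} {y z : F}
    {ψ : ℝ × E → F} (hψ : Tendsto ψ (𝓝[>] (0 : ℝ) ×ˢ 𝓝 w) (𝓝 z))
    (heq : ∀ t : ℝ, 0 < t → ∀ w', h (y + t • ψ (t, w')) = f (x + t • w')) (h0 : h y = f x) :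
    subderivative h y z ≤ subderivative f x w := by
  have hmap : Tendsto (fun p : ℝ × E => (p.1, ψ p)) (𝓝[>] (0 : ℝ) ×ˢ 𝓝 w)
      (𝓝[>] (0 : ℝ) ×ˢ 𝓝 z) := tendsto_fst.prodMk hψ
  refine (liminf_le_liminf_of_le hmap).trans ?_
  rw [← liminf_comp]
  refine liminf_le_liminf ?_
  filter_upwards [tendsto_fst.eventually (self_mem_nhdsWithin (a := (0 : ℝ)) (s := Set.Ioi 0))]
    with p hp
  simp only [Function.comp_apply]
  rw [heq p.1 hp, h0]

end Subderivative

/-! ### Spectral functions -/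

section Spectral

variable {n : ℕ} {θ : EuclideanSpace ℝ (Fin n) → EReal} {g : symMat (Fin n) → EReal}

theorem apply_conjDiag (hθ : IsSymmetricFun θ) (hg : ∀ Z, g Z = θ (eig Z))
    {Q : Matrix (Fin n) (Fin n) ℝ} (hQ : Q ∈ Matrix.orthogonalGroup (Fin n) ℝ)
    (z : EuclideanSpace ℝ (Fin n)) : g (conjDiag Q z) = θ z := by
  let σ := Tuple.sort fun i => -z i
  have hanti : Antitone fun i => z (σ i) := fun i j hij =>
    neg_le_neg_iff.1 (Tuple.monotone_sort (fun i => -z i) hij)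
  have h1 : conjDiag Q z =
      conjDiag (Q.submatrix id σ) (WithLp.toLp 2 fun i => z (σ i) : EuclideanSpace ℝ (Fin n)) :=
    (conjDiag_comp_perm Q z σ).symm
  rw [hg, h1, eig_conjDiag (submatrix_perm_mem_orthogonalGroup hQ σ) hanti]
  exact hθ σ z

/-- Testing the subgradient inequality at a conjugate of `X` diagonalized along with `Y` gives
equality in the trace inequality. -/
theorem orthDiag_inter_nonempty_of_mem_subdifferential (hθ : IsSymmetricFun θ)
    (hg : ∀ Z, g Z = θ (eig Z)) {X Y : symMat (Fin n)} (hY : Y ∈ subdifferential g X) :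
    (orthDiag X ∩ orthDiag Y).Nonempty := by
  obtain ⟨hbot, htop, hsub⟩ := hY
  obtain ⟨Q, hQ⟩ := orthDiag_nonempty Y
  apply orthDiag_inter_nonempty_of_inner_eq
  refine le_antisymm (inner_le_sum_eig X Y) ?_
  have h := hsub (conjDiag Q (eig X))
  rw [apply_conjDiag hθ hg hQ.1, ← hg, inner_sub_right] at h
  have h1 : inner ℝ Y (conjDiag Q (eig X)) = ∑ i, eig X i * eig Y i := by
    conv_lhs => rw [eq_conjDiag_of_mem_orthDiag hQ]
    rw [inner_conjDiag_self hQ.1]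
    exact Finset.sum_congr rfl fun i _ => mul_comm _ _
  rw [h1, real_inner_comm] at h
  lift g X to ℝ using ⟨htop, hbot⟩ with r
  have h2 : r + (∑ i, eig X i * eig Y i - inner ℝ X Y) ≤ r := by exact_mod_cast h
  linarith

theorem eig_mem_subdifferential (hθ : IsSymmetricFun θ) (hg : ∀ Z, g Z = θ (eig Z))
    {X Y : symMat (Fin n)} (hY : Y ∈ subdifferential g X) :
    eig Y ∈ subdifferential θ (eig X) := by
  obtain ⟨U, hUX, hUY⟩ := orthDiag_inter_nonempty_of_mem_subdifferential hθ hg hY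
  obtain ⟨hbot, htop, hsub⟩ := hY
  rw [hg] at hbot htop hsub
  refine ⟨hbot, htop, fun z => ?_⟩
  have h := hsub (conjDiag U z)
  rw [apply_conjDiag hθ hg hUX.1] at h
  convert h using 3
  conv_rhs => rw [eq_conjDiag_of_mem_orthDiag hUX, eq_conjDiag_of_mem_orthDiag hUY]
  rw [← conjDiag_sub, inner_conjDiag_self hUX.1, ← sum_eq_inner]
  rfl

/-- The chain rule for spectral functions. Directions `w'` near `dirDeriv eig X H` are realized by
the matrices `Q Diag(eig X + t w') Qᵀ` with `Q` diagonalizing `X + t H`, which differ from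
`X + t H` by `o(t)`. -/
theorem subderivative_spectral (hθ : IsSymmetricFun θ) (hg : ∀ Z, g Z = θ (eig Z))
    (X H : symMat (Fin n)) :
    subderivative g X H = subderivative θ (eig X) (dirDeriv eig X H) := by
  have hdir := hasDirDeriv_eig X H
  apply le_antisymm
  · choose Q hQ using fun t : ℝ => orthDiag_nonempty (X + t • H)
    refine subderivative_le_subderivative
      (ψ := fun p => p.1⁻¹ • (conjDiag (Q p.1) (eig X + p.1 • p.2) - X)) ?_ ?_ (hg X)
    · have hlim : Tendsto (fun p : ℝ × EuclideanSpace ℝ (Fin n) =>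
          ‖p.2 - p.1⁻¹ • (eig (X + p.1 • H) - eig X)‖)
          (𝓝[>] (0 : ℝ) ×ˢ 𝓝 (dirDeriv eig X H)) (𝓝 0) := by
        have h1 : Tendsto (fun p : ℝ × EuclideanSpace ℝ (Fin n) =>
            p.2 - p.1⁻¹ • (eig (X + p.1 • H) - eig X)) (𝓝[>] (0 : ℝ) ×ˢ 𝓝 (dirDeriv eig X H))
            (𝓝 (dirDeriv eig X H - dirDeriv eig X H)) :=
          tendsto_snd.sub (hdir.comp tendsto_fst)
        simpa using h1.norm
      refine tendsto_iff_norm_sub_tendsto_zero.2 (hlim.congr' ?_)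
      filter_upwards [tendsto_fst.eventually
        (self_mem_nhdsWithin (a := (0 : ℝ)) (s := Set.Ioi 0))] with p hp
      have hp : p.1 ≠ 0 := ne_of_gt hp
      have h1 : p.1⁻¹ • (conjDiag (Q p.1) (eig X + p.1 • p.2) - X) - H =
          p.1⁻¹ • conjDiag (Q p.1) (eig X + p.1 • p.2 - eig (X + p.1 • H) :
            EuclideanSpace ℝ (Fin n)) := by
        have h2 : conjDiag (Q p.1) (eig X + p.1 • p.2 - eig (X + p.1 • H) :
            EuclideanSpace ℝ (Fin n)) = conjDiag (Q p.1) (eig X + p.1 • p.2) - (X + p.1 • H) := by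
          nth_rewrite 2 [eq_conjDiag_of_mem_orthDiag (hQ p.1)]
          exact conjDiag_sub _ _ _
        rw [h2, ← sub_sub, smul_sub _ _ (p.1 • H), inv_smul_smul₀ hp]
      have h3 : p.2 - p.1⁻¹ • (eig (X + p.1 • H) - eig X) =
          p.1⁻¹ • (eig X + p.1 • p.2 - eig (X + p.1 • H)) := by
        rw [add_sub_right_comm, smul_add, inv_smul_smul₀ hp, ← neg_sub (eig X), smul_neg]
        abel
      rw [h1, norm_smul, norm_conjDiag (hQ p.1).1, h3, norm_smul]
    · intro t ht w'
      dsimp only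
      rw [smul_inv_smul₀ ht.ne', add_sub_cancel]
      exact apply_conjDiag hθ hg (hQ t).1 (eig X + t • w')
  · refine subderivative_le_subderivative
      (ψ := fun p => p.1⁻¹ • (eig (X + p.1 • p.2) - eig X)) ?_ ?_ (hg X).symm
    · exact tendsto_slope_of_hasDirDeriv norm_eig_sub_eig_le hdir
    · intro t ht w'
      dsimp only
      rw [smul_inv_smul₀ ht.ne', add_sub_cancel, hg]

end Spectral

end

end SpectralCone

open SpectralCone in
theorem proposition5p4 (n : ℕ)
    (θ : EuclideanSpace ℝ (Fin n) → EReal) (hθ : IsSymmetricFun θ)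
    (g : symMat (Fin n) → EReal) (hg : ∀ Z, g Z = θ (eig Z))
    (hlsc : LowerSemicontinuous g) (hconv : IsConvexFun g)
    (X Y : symMat (Fin n)) (hY : Y ∈ subdifferential g X)
    (r : ℕ) (μ : Fin r → ℝ) (hμ : StrictAnti μ)
    (hμX : Set.range μ = spectrum ℝ (X : Matrix (Fin n) (Fin n) ℝ)) :
    (orthDiag X ∩ orthDiag Y).Nonempty ∧
    eig Y ∈ subdifferential θ (eig X) ∧
    (∀ H : symMat (Fin n), HasDirDeriv eig X H (dirDeriv eig X H)) ∧
    ∀ U ∈ orthDiag X ∩ orthDiag Y, ∀ H : symMat (Fin n),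
      H ∈ criticalCone g X Y ↔
        dirDeriv eig X H ∈ criticalCone θ (eig X) (eig Y) ∧
        ∀ m : Fin r,
          HasSimOrdSpectralDecomp (eigDiagBlock Y (eigIndex X (μ m)))
            (colCompression U (eigIndex X (μ m)) H) := by
  have hsub := eig_mem_subdifferential hθ hg hY
  refine ⟨orthDiag_inter_nonempty_of_mem_subdifferential hθ hg hY, hsub,
    fun H => hasDirDeriv_eig X H, ?_⟩
  rintro U ⟨hUX, hUY⟩ H
  obtain ⟨hle, hiff⟩ := inner_le_inner_dirDeriv_eig hUX hUY H
  have hblocks : (∀ m : Fin r, HasSimOrdSpectralDecomp (eigDiagBlock Y (eigIndex X (μ m)))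
      (colCompression U (eigIndex X (μ m)) H)) ↔
      inner ℝ Y H = inner ℝ (eig Y) (dirDeriv eig X H) := by
    rw [spectrum_eq_range_eig] at hμX
    rw [hiff]
    constructor
    · intro h i
      obtain ⟨m, hm⟩ := hμX.ge (Set.mem_range_self i)
      exact hm ▸ h m
    · intro h m
      obtain ⟨i, hi⟩ := hμX.le (Set.mem_range_self m)
      exact hi ▸ h i
  have hdθ := inner_le_subderivative hsub (dirDeriv eig X H)
  rw [hblocks, criticalCone, criticalCone, Set.mem_ofPred_eq, Set.mem_ofPred_eq,
    subderivative_spectral hθ hg]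
  constructor
  · intro h
    -- `⟨Y, H⟩ ≤ ⟨eig Y, dirDeriv eig X H⟩ ≤ dθ = ⟨Y, H⟩` collapses to equalities.
    rw [h, EReal.coe_le_coe_iff] at hdθ
    have heq := le_antisymm hle hdθ
    exact ⟨by rw [h, heq], heq⟩
  · rintro ⟨h, heq⟩
    rw [h, heq]
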